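/- All simplicial complexes are finite and abstract: a simplicial complex $\Delta$ is a finite collection of finite sets (faces) closed under taking subsets, so that $\varnothing$ is a face unless $\Delta$ is void. A face with $i$ elements has dimension $i-1$. If $\Delta$ has dimension $n-1$ and $f_{i-1}(\Delta)$ faces of dimension $i-1$, its $h$-polynomial is $$h(\Delta,x)=\sum_{i=0}^{n} f_{i-1}(\Delta)\,x^i(1-x)^{n-i},$$ and the void complex has $h$-polynomial $0$. For $F\in\Delta$ let $\mathrm{link}_\Delta(F)=\{G\setminus F: G\in\Delta,\ F\subseteq G\}$. The barycentric subdivision $\mathrm{sd}(\Delta)$ is the simplicial complex whose faces are the chains of nonempty faces of $\Delta$, ordered by inclusion. A triangulation of $\Delta$ is a simplicial complex $\Delta'$ together with a geometric realization $K'$ of $\Delta'$ that geometrically subdivides a geometric realization $K$ of $\Delta$ (that is, $K'$ and $K$ have the same underlying space in some $\mathbb{R}^N$, and every simplex of $K'$ lies in a simplex of $K$). For $F\in\Delta$, the restriction $\Delta'_F$ consists of the faces of $\Delta'$ whose simplex in $K'$ is contained in the simplex of $K$ corresponding to $F$; it is a triangulation of the simplex $2^F$. For such a triangulated ball $\Gamma=\Delta'_F$,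 let $\partial\Gamma$ be its boundary, that is, the subcomplex generated by the faces of codimension one which lie in exactly one facet (so $\partial\{\varnothing\}$ is void), and let $$\theta(\Gamma,x)=h(\Gamma,x)-h(\partial\Gamma,x)$$ be its theta polynomial. Theorem. For every pure simplicial complex $\Delta$ (that is, all facets of $\Delta$ have the same dimension) and every triangulation $\Delta'$ of $\Delta$, $$h(\Delta',x)=\sum_{F\in\Delta}\theta(\Delta'_F,x)\,h(\mathrm{sd}(\mathrm{link}_\Delta(F)),x).$$ -/

import Mathlib

open Polynomial

/-- A finite abstract simplicial complex: a finite collection of finite subsets of `V` (the faces)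
that is closed under taking subsets. The void complex (no face at all) is allowed; it differs from
the complex `{∅}`. The empty set is a face of every other complex. -/
@[ext]
structure FinComplex (V : Type*) where
  faces : Finset (Finset V)
  down_closed : ∀ F G : Finset V, G ∈ faces → F ⊆ G → F ∈ faces

namespace FinComplex

noncomputable section

open scoped Classical

variable {V W : Type*}

/-- The maximal cardinality of a face, that is, `dim Δ + 1`. -/
def rank (Δ : FinComplex V) : ℕ := Δ.faces.sup Finset.card

/-- The facets: the faces that are maximal with respect to inclusion. -/
def facets (Δ : FinComplex V) : Finset (Finset V) :=
  Δ.faces.filter fun F => ∀ G ∈ Δ.faces, F ⊆ G → F = G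

/-- `Δ` is pure if all its facets have the same dimension. -/
def IsPure (Δ : FinComplex V) : Prop :=
  ∀ F ∈ Δ.facets, ∀ G ∈ Δ.facets, F.card = G.card

/-- The number of faces with `i` elements, that is, `f_{i-1}(Δ)`. -/
def numFaces (Δ : FinComplex V) (i : ℕ) : ℕ := (Δ.faces.filter fun F => F.card = i).card

/-- The `h`-polynomial `h(Δ, x) = ∑_{i=0}^n f_{i-1}(Δ) x^i (1-x)^{n-i}` with `n = dim Δ + 1`.
It is zero for the void complex. -/
def hPoly (Δ : FinComplex V) : ℝ[X] :=
  ∑ i ∈ Finset.range (Δ.rank + 1), C (Δ.numFaces i : ℝ) * X ^ i * (1 - X) ^ (Δ.rank - i)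

/-- The link `{G \ F : G ∈ Δ, F ⊆ G}` of the face `F`. -/
def link (Δ : FinComplex V) (F : Finset V) : FinComplex V where
  faces := (Δ.faces.filter fun G => F ⊆ G).image fun G => G \ F
  down_closed := by
    intro A B hB hAB
    simp only [Finset.mem_image, Finset.mem_filter] at hB ⊢
    obtain ⟨G, ⟨hG, hFG⟩, rfl⟩ := hB
    refine ⟨A ∪ F, ⟨Δ.down_closed _ G hG ?_, Finset.subset_union_right⟩, ?_⟩
    · exact Finset.union_subset (hAB.trans Finset.sdiff_subset) hFG
    · ext x
      have := @hAB x
      simp only [Finset.mem_sdiff, Finset.mem_union] at this ⊢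
      tauto

/-- The barycentric subdivision: its vertices are the nonempty faces of `Δ`, and its faces are the
chains (with respect to inclusion) of nonempty faces of `Δ`. -/
def sd (Δ : FinComplex V) : FinComplex (Finset V) where
  faces := (Δ.faces.erase ∅).powerset.filter
    fun c => IsChain (fun F G : Finset V => F ⊆ G) (c : Set (Finset V))
  down_closed := by
    intro A B hB hAB
    simp only [Finset.mem_filter, Finset.mem_powerset] at hB ⊢
    exact ⟨hAB.trans hB.1, hB.2.mono (by exact_mod_cast hAB)⟩

/-- The boundary of `Γ`: the subcomplex generated by the faces of codimension one that lie in
exactly one facet. This is the boundary `∂Γ` whenever `Γ` is a homology ball (for instance, a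
triangulation of a simplex): the link of a codimension one face consists of two points if the face
is interior and of one point if it is on the boundary, and `∂Γ` is pure of codimension one. The
boundary of `{∅}` is the void complex, and the boundary of a single point is `{∅}`. -/
def boundary (Γ : FinComplex V) : FinComplex V where
  faces := Γ.faces.filter fun F => ∃ R ∈ Γ.faces,
    R.card + 1 = Γ.rank ∧ (Γ.facets.filter fun T => R ⊂ T).card = 1 ∧ F ⊆ R
  down_closed := by
    intro A B hB hAB
    simp only [Finset.mem_filter] at hB ⊢
    obtain ⟨hB, R, hR, h1, h2, h3⟩ := hB
    exact ⟨Γ.down_closed _ B hB hAB, R, hR, h1, h2, hAB.trans h3⟩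

/-- The theta polynomial `θ(Γ, x) = h(Γ, x) - h(∂Γ, x)`. -/
def theta (Γ : FinComplex V) : ℝ[X] := Γ.hPoly - Γ.boundary.hPoly

/-- The geometric simplicial complex `K` is a geometric realization of `Δ`, where the vertex `v`
of `Δ` is placed at the point `p v`. (Mathlib's geometric complexes have no empty face.) -/
def IsRealization {E : Type*} [AddCommGroup E] [Module ℝ E] (Δ : FinComplex V)
    (K : Geometry.SimplicialComplex ℝ E) (p : V → E) : Prop :=
  Set.InjOn p {v | {v} ∈ Δ.faces} ∧
    K.faces = {s : Finset E | ∃ F ∈ Δ.faces, F.Nonempty ∧ (s : Set E) = p '' (F : Set V)}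

/-- The geometric simplicial complex `K'` subdivides `K`: both have the same underlying space, and
every simplex of `K'` is contained in a simplex of `K`. -/
def Subdivides {E : Type*} [AddCommGroup E] [Module ℝ E]
    (K' K : Geometry.SimplicialComplex ℝ E) : Prop :=
  K'.space = K.space ∧
    ∀ s ∈ K'.faces, ∃ t ∈ K.faces, convexHull ℝ (s : Set E) ⊆ convexHull ℝ (t : Set E)

/-- A (geometric) triangulation `Δ'` of `Δ`: a geometric realization of `Δ'` that subdivides a
geometric realization of `Δ` in some `ℝ^N`. The last field only concerns the empty face, which
geometric realizations do not see: the void complex is triangulated only by the void complex. -/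
structure Triangulation (Δ' : FinComplex W) (Δ : FinComplex V) where
  N : ℕ
  K : Geometry.SimplicialComplex ℝ (EuclideanSpace ℝ (Fin N))
  K' : Geometry.SimplicialComplex ℝ (EuclideanSpace ℝ (Fin N))
  pos : V → EuclideanSpace ℝ (Fin N)
  pos' : W → EuclideanSpace ℝ (Fin N)
  realizes : Δ.IsRealization K pos
  realizes' : Δ'.IsRealization K' pos'
  subdivides : Subdivides K' K
  empty_mem_iff : ∅ ∈ Δ'.faces ↔ ∅ ∈ Δ.faces

/-- The restriction `Δ'_F` of a triangulation `Δ'` of `Δ` to a face `F` of `Δ`: the faces of `Δ'`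
whose simplex is contained in the simplex of `F` (equivalently, whose carrier is a subset
of `F`). -/
def Triangulation.restrict {Δ' : FinComplex W} {Δ : FinComplex V} (T : Triangulation Δ' Δ)
    (F : Finset V) : FinComplex W where
  faces := Δ'.faces.filter fun G =>
    convexHull ℝ (T.pos' '' (G : Set W)) ⊆ convexHull ℝ (T.pos '' (F : Set V))
  down_closed := by
    intro A B hB hAB
    simp only [Finset.mem_filter] at hB ⊢
    exact ⟨Δ'.down_closed _ B hB.1 hAB,
      (convexHull_mono (Set.image_mono (by exact_mod_cast hAB))).trans hB.2⟩

end

end FinComplex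

open Polynomial

namespace FinComplex

noncomputable section

open scoped Classical
open Filter Topology

variable {V W : Type*}

/-! Replace the complexes by cones of nonnegative weight functions supported on faces. Sending each
vertex of `Δ'` to its barycentric coordinates in `Δ` gives a linear map `L` that is a bijection
between the cones (`Triangulation.exists_bijOn_cone`); from there on only `L` matters. Each face `s`
of `Δ'` has a carrier in `Δ`, and `Δ'_F` consists of the faces with carrier inside `F`.

Write n for the rank of `Δ`, i_F for `interiorPoly Δ' L F`, the part of the h-polynomial due to
faces with carrier exactly F, and H_F for h(sd(link F)). Sorting faces by carrier gives h(Δ') = ∑_F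
(1-x)^(n-|F|) i_F. Boundary faces of `Δ'_F` are those with carrier different from F
(`mem_faces_boundary`), so θ(Δ'_F) = i_F - x ∑_{E⊂F} (1-x)^(|F|-1-|E|) i_E (`theta_eq`). Removing
the least element of a chain gives H_E = (1-x)^(n-|E|) + x ∑_{F⊃E} (1-x)^(|F|-1-|E|) H_F
(`hPoly_sd_link_recursion`). In ∑_F θ(Δ'_F) H_F the coefficient of i_E is therefore (1-x)^(n-|E|),
as in h(Δ'). -/

/-! ### Cones of weight functions and small perturbations. -/

/-- The cone over `Δ`: the nonnegative weight functions supported on a face. -/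
def cone (Δ : FinComplex V) : Set (V →₀ ℝ) := {y | 0 ≤ y ∧ y.support ∈ Δ.faces}

/-- The indicator function of a finite set, as a weight function. -/
def ones (s : Finset W) : W →₀ ℝ := Finsupp.indicator s fun _ _ => 1

lemma ones_apply (s : Finset W) (w : W) : ones s w = if w ∈ s then 1 else 0 := by
  simp [ones, Finsupp.indicator_apply]

@[simp] lemma support_ones (s : Finset W) : (ones s).support = s := by
  ext w; simp [ones_apply]

lemma ones_nonneg (s : Finset W) : 0 ≤ ones s := fun w => by
  rw [ones_apply]; split_ifs <;> simp

lemma mem_cone {Δ : FinComplex V} {y : V →₀ ℝ} {F : Finset V} (hy : 0 ≤ y) (hF : F ∈ Δ.faces)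
    (h : y.support ⊆ F) : y ∈ Δ.cone :=
  ⟨hy, Δ.down_closed _ _ hF h⟩

lemma ones_mem_cone {Δ : FinComplex V} {F : Finset V} (hF : F ∈ Δ.faces) : ones F ∈ Δ.cone :=
  mem_cone (ones_nonneg F) hF (support_ones F).subset

lemma support_pos {x : V →₀ ℝ} (hx : 0 ≤ x) {v : V} (hv : v ∈ x.support) : 0 < x v :=
  lt_of_le_of_ne (hx v) (Ne.symm (Finsupp.mem_support_iff.1 hv))

lemma eventually_add_smul_nonneg {x b : V →₀ ℝ} (hx : 0 ≤ x) (hb : b.support ⊆ x.support) :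
    ∀ᶠ ε in 𝓝[>] (0 : ℝ), 0 ≤ x + ε • b := by
  have h : ∀ᶠ ε in 𝓝[>] (0 : ℝ), ∀ v ∈ x.support, 0 < x v + ε * b v := by
    rw [Filter.eventually_all_finset]
    intro v hv
    apply tendsto_nhdsWithin_of_tendsto_nhds _ |>.eventually_const_lt (support_pos hx hv)
    have : Continuous fun ε : ℝ => x v + ε * b v := by fun_prop
    simpa using this.tendsto 0
  filter_upwards [h] with ε hε v
  by_cases hv : v ∈ x.support
  · simpa using (hε v hv).le
  · have h1 : x v = 0 := by simpa using hv
    have h2 : b v = 0 := by simpa using fun h => hv (hb h)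
    simp [h1, h2]

lemma exists_pos_add_smul_nonneg {x b : V →₀ ℝ} (hx : 0 ≤ x) (hb : b.support ⊆ x.support) :
    ∃ ε : ℝ, 0 < ε ∧ 0 ≤ x + ε • b := by
  obtain ⟨ε, h1, h2⟩ := ((eventually_add_smul_nonneg hx hb).and self_mem_nhdsWithin).exists
  exact ⟨ε, h2, h1⟩

lemma support_add_smul_subset {x b : V →₀ ℝ} {F : Finset V} (hx : x.support ⊆ F)
    (hb : b.support ⊆ F) (ε : ℝ) : (x + ε • b).support ⊆ F :=
  Finsupp.support_add.trans (Finset.union_subset hx (Finsupp.support_smul.trans hb))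

lemma eventually_add_smul_mem_cone {Δ : FinComplex V} {x b : V →₀ ℝ} {F : Finset V} (hx : 0 ≤ x)
    (hF : F ∈ Δ.faces) (hxF : x.support = F) (hb : b.support ⊆ F) :
    ∀ᶠ ε in 𝓝[>] (0 : ℝ), x + ε • b ∈ Δ.cone := by
  filter_upwards [eventually_add_smul_nonneg hx (hxF ▸ hb)] with ε hε
  exact mem_cone hε hF (support_add_smul_subset hxF.subset hb ε)

/-! ### Carriers for a linear map that is bijective on cones. -/

variable {Δ' : FinComplex W} {Δ : FinComplex V} {L : (W →₀ ℝ) →ₗ[ℝ] (V →₀ ℝ)}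

/-- The carrier of a set of vertices: the support of the image of a point in its interior. -/
def carrier (L : (W →₀ ℝ) →ₗ[ℝ] (V →₀ ℝ)) (s : Finset W) : Finset V := (L (ones s)).support

/-- Injectivity on the cone becomes linear injectivity on the span of a face: `ones s` is interior
to its cell, so it can be moved slightly along a kernel vector `a` of any sign without leaving the
cone or changing its image. -/
lemma eq_zero_of_map_eq_zero (hL : Set.BijOn L Δ'.cone Δ.cone) {s : Finset W}
    (hs : s ∈ Δ'.faces) {a : W →₀ ℝ} (ha : a.support ⊆ s) (h0 : L a = 0) : a = 0 := by
  obtain ⟨ε, hε, h⟩ := exists_pos_add_smul_nonneg (ones_nonneg s) (by simpa using ha)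
  have h1 : ones s + ε • a ∈ Δ'.cone :=
    mem_cone h hs (support_add_smul_subset (support_ones s).subset ha ε)
  have h2 := hL.injOn h1 (ones_mem_cone hs) (by simp [h0])
  simpa [hε.ne'] using h2

lemma eq_of_map_eq (hL : Set.BijOn L Δ'.cone Δ.cone) {s : Finset W}
    (hs : s ∈ Δ'.faces) {a b : W →₀ ℝ} (ha : a.support ⊆ s) (hb : b.support ⊆ s)
    (h : L a = L b) : a = b := by
  rw [← sub_eq_zero]
  exact eq_zero_of_map_eq_zero hL hs (Finsupp.support_sub.trans (Finset.union_subset ha hb))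
    (by simp [h])

/-- For small ε the weight `z - ε • y` is still in the cone, so `L z ≥ ε • L y`. -/
lemma support_map_mono (hL : Set.BijOn L Δ'.cone Δ.cone) {y z : W →₀ ℝ} (hy : y ∈ Δ'.cone)
    (hz : z ∈ Δ'.cone) (h : y.support ⊆ z.support) : (L y).support ⊆ (L z).support := by
  obtain ⟨ε, hε, hn⟩ := exists_pos_add_smul_nonneg (b := -y) hz.1 (by simpa using h)
  have h1 : z + ε • (-y) ∈ Δ'.cone :=
    mem_cone hn hz.2 (support_add_smul_subset subset_rfl (by simpa using h) ε)
  have h2 := (hL.mapsTo h1).1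
  intro v hv
  have h3 := support_pos (hL.mapsTo hy).1 hv
  have h4 := h2 v
  simp only [map_add, map_smul, map_neg, Finsupp.coe_zero, Pi.zero_apply, Finsupp.add_apply,
    Finsupp.smul_apply, Finsupp.neg_apply, smul_eq_mul] at h4
  have := mul_pos hε h3
  rw [Finsupp.mem_support_iff]
  linarith

lemma support_map_eq_carrier (hL : Set.BijOn L Δ'.cone Δ.cone) {y : W →₀ ℝ} (hy : y ∈ Δ'.cone) :
    (L y).support = carrier L y.support :=
  (support_map_mono hL hy (ones_mem_cone hy.2) (by simp)).antisymm
    (support_map_mono hL (ones_mem_cone hy.2) hy (by simp))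

lemma carrier_mem (hL : Set.BijOn L Δ'.cone Δ.cone) {s : Finset W} (hs : s ∈ Δ'.faces) :
    carrier L s ∈ Δ.faces :=
  (hL.mapsTo (ones_mem_cone hs)).2

lemma carrier_mono (hL : Set.BijOn L Δ'.cone Δ.cone) {s t : Finset W} (ht : t ∈ Δ'.faces)
    (hst : s ⊆ t) : carrier L s ⊆ carrier L t :=
  support_map_mono hL (ones_mem_cone (Δ'.down_closed _ _ ht hst)) (ones_mem_cone ht) (by simpa)

lemma support_map_subset_carrier (hL : Set.BijOn L Δ'.cone Δ.cone) {s : Finset W}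
    (hs : s ∈ Δ'.faces) {a : W →₀ ℝ} (ha : a.support ⊆ s) : (L a).support ⊆ carrier L s := by
  obtain ⟨ε, hε, hn⟩ := exists_pos_add_smul_nonneg (ones_nonneg s) (by simpa using ha)
  have h1 : ones s + ε • a ∈ Δ'.cone :=
    mem_cone hn hs (support_add_smul_subset (support_ones s).subset ha ε)
  have h2 := support_map_mono hL h1 (ones_mem_cone hs) (by
    rw [support_ones]
    exact support_add_smul_subset (support_ones s).subset ha ε)
  intro v hv
  by_contra hc
  have h3 : L (ones s) v = 0 := by simpa [carrier] using hc
  have h4 : L (ones s + ε • a) v = 0 := by simpa using fun h => hc (h2 h)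
  rw [Finsupp.mem_support_iff] at hv
  simp [h3, hε.ne', hv] at h4

/-- A direction that points into the cone over `Δ` lifts to a direction that points into a cell of
the cone over `Δ'`. -/
lemma exists_lift_direction (hL : Set.BijOn L Δ'.cone Δ.cone) {x : W →₀ ℝ} (hx : x ∈ Δ'.cone)
    {b : V →₀ ℝ} (hb : ∀ᶠ ε in 𝓝[>] (0 : ℝ), L x + ε • b ∈ Δ.cone) :
    ∃ a, L a = b ∧ ∃ ε : ℝ, 0 < ε ∧ x + ε • a ∈ Δ'.cone ∧
      x.support ⊆ (x + ε • a).support := by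
  -- Pigeonhole: there are finitely many cells, so one cell `t` contains the lifts for arbitrarily
  -- small ε.
  have key : ∃ t ∈ Δ'.faces, ∃ᶠ ε in 𝓝[>] (0 : ℝ), ∃ a, 0 ≤ a ∧ a.support = t ∧
      L a = L x + ε • b := by
    by_contra! hc
    rw [← Filter.eventually_all_finset] at hc
    obtain ⟨ε, h1, h2⟩ := (hb.and hc).exists
    obtain ⟨a, ha, hae⟩ := hL.surjOn h1
    exact h2 _ ha.2 a ha.1 rfl hae
  obtain ⟨t, ht, hfr⟩ := key
  obtain ⟨ε₁, ⟨a₁, ha₁, hs₁, he₁⟩, hε₁⟩ := (hfr.and_eventually self_mem_nhdsWithin).exists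
  obtain ⟨ε₂, ⟨a₂, ha₂, hs₂, he₂⟩, hε₂⟩ :=
    (hfr.and_eventually (Ioo_mem_nhdsGT (show (0 : ℝ) < ε₁ from hε₁))).exists
  have hd : ε₁ - ε₂ ≠ 0 := by linarith [hε₂.2]
  -- Two lifts in the same cell determine the slope of the lifted ray; all lifts in `t` lie on it
  -- because `L` is injective on the span of `t`.
  set a := (ε₁ - ε₂)⁻¹ • (a₁ - a₂) with ha
  have hat : a.support ⊆ t := Finsupp.support_smul.trans
    (Finsupp.support_sub.trans (Finset.union_subset hs₁.subset hs₂.subset))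
  have hLa : L a = b := by
    rw [ha, map_smul, map_sub, he₁, he₂, add_sub_add_left_eq_sub, ← sub_smul, smul_smul,
      inv_mul_cancel₀ hd, one_smul]
  have hLx : L (a₁ - ε₁ • a) = L x := by simp [he₁, hLa]
  have hxt : (a₁ - ε₁ • a).support ⊆ t := by
    simpa [sub_eq_add_neg] using support_add_smul_subset hs₁.subset hat (-ε₁)
  have hfr' : ∃ᶠ ε in 𝓝[>] (0 : ℝ), 0 ≤ (a₁ - ε₁ • a) + ε • a := by
    refine hfr.mono ?_
    rintro ε ⟨c, hc, hct, hce⟩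
    have : c = (a₁ - ε₁ • a) + ε • a := by
      apply eq_of_map_eq hL ht hct.subset (support_add_smul_subset hxt hat ε)
      rw [map_add, hLx, hce, map_smul, hLa]
    rwa [← this]
  -- The start of the ray is a limit of points of the closed cell `t`, so it lies in the cone and
  -- must be `x` by injectivity.
  have hpos : 0 ≤ a₁ - ε₁ • a := by
    intro w
    by_contra hw
    simp only [Finsupp.coe_zero, Pi.zero_apply, not_le] at hw
    have h : ∀ᶠ ε in 𝓝[>] (0 : ℝ), (a₁ - ε₁ • a) w + ε * a w < 0 := by
      apply tendsto_nhdsWithin_of_tendsto_nhds _ |>.eventually_lt_const hw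
      have : Continuous fun ε : ℝ => (a₁ - ε₁ • a) w + ε * a w := by fun_prop
      simpa using this.tendsto 0
    obtain ⟨ε, h1, h2⟩ := (hfr'.and_eventually h).exists
    exact absurd (h1 w) (by simpa using h2)
  have hxe : a₁ - ε₁ • a = x := hL.injOn (mem_cone hpos ht hxt) hx hLx
  have ha₁e : x + ε₁ • a = a₁ := by rw [← hxe]; simp
  refine ⟨a, hLa, ε₁, hε₁, ?_, ?_⟩
  · rw [ha₁e]; exact ⟨ha₁, hs₁ ▸ ht⟩
  · rw [ha₁e, hs₁, ← hxe]; exact hxt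

/-! ### Dimension counts and extension of faces. -/

lemma finrank_supported (s : Finset V) :
    Module.finrank ℝ (Finsupp.supported ℝ ℝ (s : Set V)) = s.card := by
  rw [(Finsupp.supportedEquivFinsupp (M := ℝ) (R := ℝ) (s : Set V)).finrank_eq]
  simp

instance finite_supported (s : Finset V) :
    Module.Finite ℝ (Finsupp.supported ℝ ℝ (s : Set V)) :=
  Module.Finite.equiv (Finsupp.supportedEquivFinsupp (M := ℝ) (R := ℝ) (s : Set V)).symm

lemma finrank_map_supported (hL : Set.BijOn L Δ'.cone Δ.cone) {s : Finset W}
    (hs : s ∈ Δ'.faces) :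
    Module.finrank ℝ ((Finsupp.supported ℝ ℝ (s : Set W)).map L) = s.card := by
  have hinj : Function.Injective (L.domRestrict (Finsupp.supported ℝ ℝ (s : Set W))) :=
    fun a b hab => Subtype.ext
      (eq_of_map_eq hL hs (by exact_mod_cast a.2) (by exact_mod_cast b.2) hab)
  rw [← LinearMap.range_domRestrict, LinearMap.finrank_range_of_inj hinj, finrank_supported]

lemma map_supported_le (hL : Set.BijOn L Δ'.cone Δ.cone) {s : Finset W} (hs : s ∈ Δ'.faces)
    {F : Finset V} (h : carrier L s ⊆ F) :
    (Finsupp.supported ℝ ℝ (s : Set W)).map L ≤ Finsupp.supported ℝ ℝ (F : Set V) := by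
  rintro _ ⟨a, ha, rfl⟩
  rw [Finsupp.mem_supported]
  exact_mod_cast (support_map_subset_carrier hL hs (by exact_mod_cast ha)).trans h

lemma card_le_of_carrier_subset (hL : Set.BijOn L Δ'.cone Δ.cone) {s : Finset W}
    (hs : s ∈ Δ'.faces) {F : Finset V} (h : carrier L s ⊆ F) : s.card ≤ F.card := by
  have := Submodule.finrank_mono (map_supported_le hL hs h)
  rwa [finrank_map_supported hL hs, finrank_supported] at this

lemma exists_map_eq_of_card_eq (hL : Set.BijOn L Δ'.cone Δ.cone) {s : Finset W}
    (hs : s ∈ Δ'.faces) {F : Finset V} (h : carrier L s ⊆ F) (hc : s.card = F.card) {b : V →₀ ℝ}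
    (hb : b.support ⊆ F) : ∃ a : W →₀ ℝ, a.support ⊆ s ∧ L a = b := by
  have heq := Submodule.eq_of_le_of_finrank_eq (map_supported_le hL hs h)
    (by rw [finrank_map_supported hL hs, finrank_supported, hc])
  have hb' : b ∈ Finsupp.supported ℝ ℝ (F : Set V) := by
    rw [Finsupp.mem_supported]; exact_mod_cast hb
  rw [← heq] at hb'
  obtain ⟨a, ha, hab⟩ := hb'
  exact ⟨a, by exact_mod_cast ha, hab⟩

lemma exists_not_map_eq_of_card_lt (L : (W →₀ ℝ) →ₗ[ℝ] (V →₀ ℝ)) {s : Finset W} {F : Finset V}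
    (hc : s.card < F.card) :
    ∃ b : V →₀ ℝ, b.support ⊆ F ∧ ∀ a : W →₀ ℝ, a.support ⊆ s → L a ≠ b := by
  by_contra! h
  have hle : Finsupp.supported ℝ ℝ (F : Set V) ≤
      (Finsupp.supported ℝ ℝ (s : Set W)).map L := by
    intro b hb
    obtain ⟨a, ha, hab⟩ := h b (by exact_mod_cast hb)
    exact ⟨a, by exact_mod_cast ha, hab⟩
  have h1 := Submodule.finrank_mono hle
  have h2 := Submodule.finrank_map_le L (Finsupp.supported ℝ ℝ (s : Set W))
  rw [finrank_supported] at h1 h2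
  omega

/-- If `s` has carrier `F` but fewer elements, it is properly contained in a face with the same
carrier, reached in any direction that is not tangent to `s`. -/
lemma exists_lift_of_carrier_eq (hL : Set.BijOn L Δ'.cone Δ.cone) {s : Finset W}
    (hs : s ∈ Δ'.faces) {b : V →₀ ℝ} (hb : b.support ⊆ carrier L s)
    (hbs : ∀ a : W →₀ ℝ, a.support ⊆ s → L a ≠ b) :
    ∃ t ∈ Δ'.faces, s ⊂ t ∧ carrier L t = carrier L s ∧
      ∃ a : W →₀ ℝ, a.support ⊆ t ∧ L a = b ∧ ∀ w ∈ t, w ∉ s → 0 < a w := by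
  obtain ⟨a, hab, ε, hε, hc, hsub⟩ := exists_lift_direction hL (ones_mem_cone hs)
    (eventually_add_smul_mem_cone (hL.mapsTo (ones_mem_cone hs)).1 (carrier_mem hL hs) rfl hb)
  rw [support_ones] at hsub
  have hat : a.support ⊆ (ones s + ε • a).support := by
    intro w hw
    by_cases hws : w ∈ s
    · exact hsub hws
    · rw [Finsupp.mem_support_iff] at hw ⊢
      simp [ones_apply, hws, hε.ne', hw]
  refine ⟨_, hc.2, ⟨hsub, fun h => hbs a (hat.trans h) hab⟩, ?_, a, hat, hab, ?_⟩
  · refine Finset.Subset.antisymm ?_ (carrier_mono hL hc.2 hsub)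
    rw [← support_map_eq_carrier hL hc, map_add, map_smul, hab]
    exact support_add_smul_subset subset_rfl hb ε
  · intro w hw hws
    have := support_pos hc.1 hw
    simpa [ones_apply, hws, hε] using this

/-- Moving from the interior of `s` in the direction `ones F` makes every coordinate in `F` positive
at once. -/
lemma exists_carrier_eq_of_subset (hL : Set.BijOn L Δ'.cone Δ.cone) {s : Finset W}
    (hs : s ∈ Δ'.faces) {F : Finset V} (hF : F ∈ Δ.faces) (h : carrier L s ⊆ F) :
    ∃ t ∈ Δ'.faces, s ⊆ t ∧ carrier L t = F := by
  have hx := ones_mem_cone hs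
  obtain ⟨a, hab, ε, hε, hc, hsub⟩ := exists_lift_direction (b := ones F) hL hx (by
    filter_upwards [self_mem_nhdsWithin] with ε hε
    refine mem_cone ?_ hF (support_add_smul_subset h (by simp) ε)
    exact add_nonneg (hL.mapsTo hx).1 (smul_nonneg (le_of_lt hε) (ones_nonneg F)))
  rw [support_ones] at hsub
  refine ⟨_, hc.2, hsub, ?_⟩
  rw [← support_map_eq_carrier hL hc, map_add, map_smul, hab]
  refine Finset.Subset.antisymm (support_add_smul_subset h (by simp) ε) fun v hv => ?_
  have h1 := (hL.mapsTo hx).1 v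
  simp only [Finsupp.coe_zero, Pi.zero_apply] at h1
  simp only [Finsupp.mem_support_iff, Finsupp.add_apply, Finsupp.smul_apply, ones_apply, hv,
    if_true, smul_eq_mul, mul_one]
  linarith

/-- The subcomplex of the faces with carrier contained in `F`. -/
def carrierRestrict (hL : Set.BijOn L Δ'.cone Δ.cone) (F : Finset V) : FinComplex W where
  faces := Δ'.faces.filter fun s => carrier L s ⊆ F
  down_closed := by
    intro A B hB hAB
    rw [Finset.mem_filter] at hB ⊢
    exact ⟨Δ'.down_closed _ _ hB.1 hAB, (carrier_mono hL hB.1 hAB).trans hB.2⟩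

lemma mem_faces_carrierRestrict (hL : Set.BijOn L Δ'.cone Δ.cone) {F : Finset V}
    {s : Finset W} :
    s ∈ (carrierRestrict hL F).faces ↔ s ∈ Δ'.faces ∧ carrier L s ⊆ F :=
  Finset.mem_filter

/-! ### Restrictions to a face: facets, rank and boundary. -/

section Restriction

variable {Γ : FinComplex W} {F : Finset V}

lemma exists_facet_superset (Γ : FinComplex W) {s : Finset W} (hs : s ∈ Γ.faces) :
    ∃ t ∈ Γ.facets, s ⊆ t := by
  obtain ⟨t, hst, ht⟩ := Γ.faces.exists_le_maximal hs
  refine ⟨t, ?_, hst⟩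
  simp only [facets, Finset.mem_filter]
  exact ⟨ht.1, fun G hG h => h.antisymm (ht.2 hG h)⟩

lemma mem_facets {t : Finset W} :
    t ∈ Γ.facets ↔ t ∈ Γ.faces ∧ ∀ G ∈ Γ.faces, t ⊆ G → t = G := by
  simp [facets]

variable (hL : Set.BijOn L Δ'.cone Δ.cone) (hF : F ∈ Δ.faces)
  (hΓ : ∀ s, s ∈ Γ.faces ↔ s ∈ Δ'.faces ∧ carrier L s ⊆ F)

include hL hF hΓ

/-- A face with smaller carrier can be enlarged towards the interior of `F`; one with carrier `F`
but too few elements can be enlarged in a direction outside its span. -/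
lemma carrier_and_card_of_mem_facets {t : Finset W} (ht : t ∈ Γ.facets) :
    carrier L t = F ∧ t.card = F.card := by
  rw [mem_facets] at ht
  obtain ⟨ht, hmax⟩ := ht
  obtain ⟨htΔ, htF⟩ := (hΓ t).1 ht
  obtain ⟨u, hu, htu, huF⟩ := exists_carrier_eq_of_subset hL htΔ hF htF
  obtain rfl := hmax u ((hΓ u).2 ⟨hu, huF.subset⟩) htu
  refine ⟨huF, (card_le_of_carrier_subset hL htΔ htF).antisymm ?_⟩
  by_contra hlt
  obtain ⟨b, hbF, hb⟩ := exists_not_map_eq_of_card_lt L (not_le.1 hlt)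
  obtain ⟨u, hu, htu, hc, -⟩ := exists_lift_of_carrier_eq hL htΔ (huF ▸ hbF) hb
  exact htu.ne (hmax u ((hΓ u).2 ⟨hu, (hc.trans huF).subset⟩) htu.subset)

omit hF in
lemma mem_facets_of_card_eq {t : Finset W} (ht : t ∈ Γ.faces) (hc : t.card = F.card) :
    t ∈ Γ.facets := by
  rw [mem_facets]
  refine ⟨ht, fun G hG h => Finset.eq_of_subset_of_card_le h ?_⟩
  obtain ⟨h1, h2⟩ := (hΓ G).1 hG
  exact hc ▸ card_le_of_carrier_subset hL h1 h2

lemma exists_superset_card_eq {s : Finset W} (hs : s ∈ Γ.faces) :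
    ∃ t ∈ Γ.faces, s ⊆ t ∧ t.card = F.card := by
  obtain ⟨t, ht, hst⟩ := exists_facet_superset Γ hs
  exact ⟨t, (mem_facets.1 ht).1, hst, (carrier_and_card_of_mem_facets hL hF hΓ ht).2⟩

lemma empty_mem_restriction : ∅ ∈ Γ.faces := by
  have h0 : (0 : V →₀ ℝ) ∈ Δ.cone := mem_cone le_rfl hF (by simp)
  obtain ⟨a, ha, -⟩ := hL.surjOn h0
  refine (hΓ ∅).2 ⟨Δ'.down_closed _ _ ha.2 (Finset.empty_subset _), ?_⟩
  have : ones (∅ : Finset W) = 0 := by ext; simp [ones_apply]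
  simp [carrier, this]

lemma rank_restriction : Γ.rank = F.card := by
  apply le_antisymm
  · refine Finset.sup_le fun G hG => ?_
    obtain ⟨h1, h2⟩ := (hΓ G).1 hG
    exact card_le_of_carrier_subset hL h1 h2
  · obtain ⟨t, ht, -, hc⟩ :=
      exists_superset_card_eq hL hF hΓ (empty_mem_restriction hL hF hΓ)
    exact hc ▸ Finset.le_sup (f := Finset.card) ht

omit hF in
/-- A codimension one face in the interior lies in at least two facets. -/
lemma card_facets_ne_one_of_carrier_eq {s : Finset W} (hs : s ∈ Δ'.faces)
    (hsF : carrier L s = F) (hc : s.card + 1 = F.card) :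
    (Γ.facets.filter fun T => s ⊂ T).card ≠ 1 := by
  obtain ⟨b, hbF, hb⟩ := exists_not_map_eq_of_card_lt L (show s.card < F.card by omega)
  have hb' : ∀ a : W →₀ ℝ, a.support ⊆ s → L a ≠ -b := fun a ha h =>
    hb (-a) (by simpa using ha) (by simp [h])
  obtain ⟨t, ht, hst, htF, a, hat, hab, hpos⟩ := exists_lift_of_carrier_eq hL hs (hsF ▸ hbF) hb
  obtain ⟨u, hu, hsu, huF, c, hcu, hcb, hpos'⟩ :=
    exists_lift_of_carrier_eq (b := -b) hL hs (by simpa using hsF ▸ hbF) hb'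
  have facet : ∀ r ∈ Δ'.faces, s ⊂ r → carrier L r = carrier L s →
      r ∈ Γ.facets.filter fun T => s ⊂ T := by
    intro r hr hsr hrF
    rw [Finset.mem_filter]
    refine ⟨mem_facets_of_card_eq hL hΓ ((hΓ r).2 ⟨hr, (hrF.trans hsF).subset⟩) ?_, hsr⟩
    have h1 := Finset.card_lt_card hsr
    have h2 := card_le_of_carrier_subset hL hr (hrF.trans hsF).subset
    omega
  intro h1
  obtain rfl : t = u := Finset.card_le_one.1 h1.le t (facet t ht hst htF) u (facet u hu hsu huF)
  obtain ⟨w, hwt, hws⟩ := Finset.exists_of_ssubset hst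
  -- If the lifts of `b` and `-b` lie in one facet, their sum is a kernel vector there; yet both are
  -- positive at `w`.
  have h0 : a + c = 0 := eq_zero_of_map_eq_zero hL ht
    (Finsupp.support_add.trans (Finset.union_subset hat hcu)) (by simp [hab, hcb])
  have h2 := DFunLike.congr_fun h0 w
  simp only [Finsupp.add_apply, Finsupp.coe_zero, Pi.zero_apply] at h2
  linarith [hpos w hwt hws, hpos' w hwt hws]

/-- A codimension one face in the boundary lies in exactly one facet. -/
lemma card_facets_eq_one_of_carrier_ne {s : Finset W} (hs : s ∈ Γ.faces)
    (hsF : carrier L s ≠ F) (hc : s.card + 1 = F.card) :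
    (Γ.facets.filter fun T => s ⊂ T).card = 1 := by
  obtain ⟨hsΔ, hsub⟩ := (hΓ s).1 hs
  obtain ⟨v, hvF, hvs⟩ := Finset.exists_of_ssubset (hsub.ssubset_of_ne hsF)
  -- The face `s` lies in the wall where coordinate `v` vanishes, and by dimension its image spans
  -- that wall.
  have hsE : carrier L s ⊆ F.erase v := Finset.subset_erase.2 ⟨hsub, hvs⟩
  have hcE : s.card = (F.erase v).card := by rw [Finset.card_erase_of_mem hvF]; omega
  have prop : ∀ t ∈ Γ.facets.filter fun T => s ⊂ T, t ∈ Δ'.faces ∧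
      ∃ w ∉ s, t = insert w s ∧ 0 < L (Finsupp.single w 1) v ∧
        (L (Finsupp.single w 1)).support ⊆ F := by
    intro t ht
    rw [Finset.mem_filter] at ht
    obtain ⟨htF, htc⟩ := carrier_and_card_of_mem_facets hL hF hΓ ht.1
    have htΔ := ((hΓ t).1 (mem_facets.1 ht.1).1).1
    obtain ⟨w, hw, hwt⟩ := Finset.ssubset_iff.1 ht.2
    have hteq : insert w s = t := Finset.eq_of_subset_of_card_le hwt (by
      rw [Finset.card_insert_of_notMem hw]; omega)
    have hwc : Finsupp.single w (1 : ℝ) ∈ Δ'.cone :=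
      mem_cone (Finsupp.single_nonneg.2 zero_le_one) htΔ
        (Finsupp.support_single_subset.trans (by
          rw [← hteq]; exact Finset.singleton_subset_iff.2 (Finset.mem_insert_self w s)))
    have hones : ones t = ones s + Finsupp.single w 1 := by
      ext x
      rw [← hteq]
      by_cases hx : x = w
      · subst hx; simp [ones_apply, hw]
      · simp [ones_apply, hx]
    refine ⟨htΔ, w, hw, hteq.symm, ?_, ?_⟩
    · have h1 : 0 < L (ones t) v := support_pos (hL.mapsTo (ones_mem_cone htΔ)).1
        (by rw [← htF] at hvF; exact hvF)
      have h2 : L (ones s) v = 0 := by simpa [carrier] using hvs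
      rw [hones, map_add, Finsupp.add_apply, h2, zero_add] at h1
      exact h1
    · refine (support_map_subset_carrier hL htΔ ?_).trans htF.subset
      refine Finsupp.support_single_subset.trans ?_
      rw [← hteq]
      exact Finset.singleton_subset_iff.2 (Finset.mem_insert_self w s)
  obtain ⟨t, ht, hst⟩ := exists_facet_superset Γ hs
  have htc := (carrier_and_card_of_mem_facets hL hF hΓ ht).2
  rw [Finset.card_eq_one]
  have htm : t ∈ Γ.facets.filter fun T => s ⊂ T := Finset.mem_filter.2
    ⟨ht, hst.ssubset_of_ne (by rintro rfl; omega)⟩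
  refine ⟨t, Finset.eq_singleton_iff_unique_mem.2 ⟨htm, fun u hu => ?_⟩⟩
  obtain ⟨htΔ, w, hw, hteq, hpos, hwF⟩ := prop t htm
  obtain ⟨huΔ, z, hz, hueq, hpos', hzF⟩ := prop u hu
  by_contra hne
  have hzw : w ≠ z := by rintro rfl; exact hne (hueq.trans hteq.symm)
  -- With this ratio the `v`-coordinates of the images of `w` and `α` times `z` cancel, so their
  -- difference lies in the wall and is the image of some `d` supported on `s`.
  set α := L (Finsupp.single w 1) v / L (Finsupp.single z 1) v with hα
  have hαpos : 0 < α := div_pos hpos hpos'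
  have hd : (L (Finsupp.single w 1) + (-α) • L (Finsupp.single z 1)).support ⊆ F.erase v := by
    refine Finset.subset_erase.2 ⟨support_add_smul_subset hwF hzF _, ?_⟩
    simp [hα, hpos'.ne']
  obtain ⟨d, hds, hdL⟩ := exists_map_eq_of_card_eq hL hsΔ hsE hcE hd
  obtain ⟨ε, hε, hn⟩ := exists_pos_add_smul_nonneg (ones_nonneg s) (by simpa using hds)
  have h1 : ones s + ε • Finsupp.single w 1 ∈ Δ'.cone := by
    refine mem_cone (add_nonneg (ones_nonneg s)
      (smul_nonneg hε.le (Finsupp.single_nonneg.2 zero_le_one))) htΔ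
      (support_add_smul_subset (by simp [hteq]) ?_ ε)
    exact Finsupp.support_single_subset.trans (by simp [hteq])
  have h2 : (ones s + ε • d) + (ε * α) • Finsupp.single z 1 ∈ Δ'.cone := by
    refine mem_cone (add_nonneg hn
      (smul_nonneg (mul_pos hε hαpos).le (Finsupp.single_nonneg.2 zero_le_one))) huΔ
      (support_add_smul_subset (support_add_smul_subset ?_ ?_ ε) ?_ _)
    · simp [hueq]
    · exact hds.trans (by simp [hueq])
    · exact Finsupp.support_single_subset.trans (by simp [hueq])
  -- The two facets on the same side of `s` overlap: two points with different `w`-coordinates have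
  -- the same image.
  have h3 := hL.injOn h1 h2 (by
    simp only [map_add, map_smul, hdL]
    module)
  have h4 := DFunLike.congr_fun h3 w
  have hdw : d w = 0 := by simpa using fun h => hw (hds h)
  simp [ones_apply, hw, hdw, hzw, hε.ne'] at h4

/-- The link between the combinatorial boundary and carriers. A face whose carrier misses `v`
extends to a facet of the restriction to `F.erase v`, which has codimension one in `Γ` and lies in a
single facet. -/
lemma mem_faces_boundary {s : Finset W} :
    s ∈ Γ.boundary.faces ↔ s ∈ Γ.faces ∧ carrier L s ≠ F := by
  simp only [boundary, Finset.mem_filter, rank_restriction hL hF hΓ]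
  refine and_congr_right fun hs => ?_
  obtain ⟨hsΔ, hsub⟩ := (hΓ s).1 hs
  constructor
  · rintro ⟨R, hR, hc, h1, hsR⟩ hsF
    obtain ⟨hRΔ, hRsub⟩ := (hΓ R).1 hR
    refine card_facets_ne_one_of_carrier_eq hL hΓ hRΔ (hRsub.antisymm ?_) hc h1
    exact hsF ▸ carrier_mono hL hRΔ hsR
  · intro hsF
    obtain ⟨v, hvF, hvs⟩ := Finset.exists_of_ssubset (hsub.ssubset_of_ne hsF)
    have hE : F.erase v ∈ Δ.faces := Δ.down_closed _ _ hF (Finset.erase_subset v F)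
    have hΓ' := fun t => mem_faces_carrierRestrict hL (s := t) (F := F.erase v)
    obtain ⟨R, hR, hsR, hRc⟩ := exists_superset_card_eq hL hE hΓ'
      ((hΓ' s).2 ⟨hsΔ, Finset.subset_erase.2 ⟨hsub, hvs⟩⟩)
    obtain ⟨hRΔ, hRE⟩ := (hΓ' R).1 hR
    have hRΓ : R ∈ Γ.faces := (hΓ R).2 ⟨hRΔ, hRE.trans (Finset.erase_subset v F)⟩
    have hRcard : R.card + 1 = F.card := by
      rw [hRc, Finset.card_erase_add_one hvF]
    refine ⟨R, hRΓ, hRcard, card_facets_eq_one_of_carrier_ne hL hF hΓ hRΓ ?_ hRcard, hsR⟩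
    rintro h
    exact Finset.notMem_erase v F (hRE (h.symm ▸ hvF))

lemma rank_boundary (hne : F.Nonempty) : Γ.boundary.rank = F.card - 1 := by
  apply le_antisymm
  · refine Finset.sup_le fun G hG => ?_
    simp only [boundary, Finset.mem_filter, rank_restriction hL hF hΓ] at hG
    obtain ⟨-, R, -, hc, -, hGR⟩ := hG
    have := Finset.card_le_card hGR
    omega
  · have h0 : (∅ : Finset W) ∈ Γ.boundary.faces := by
      rw [mem_faces_boundary hL hF hΓ]
      refine ⟨empty_mem_restriction hL hF hΓ, ?_⟩
      have : ones (∅ : Finset W) = 0 := by ext; simp [ones_apply]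
      simpa [carrier, this] using hne.ne_empty.symm
    simp only [boundary, Finset.mem_filter, rank_restriction hL hF hΓ] at h0
    obtain ⟨-, R, hR, hc, h1, -⟩ := h0
    have hRb : R ∈ Γ.boundary.faces := by
      simp only [boundary, Finset.mem_filter, rank_restriction hL hF hΓ]
      exact ⟨hR, R, hR, hc, h1, subset_rfl⟩
    have := Finset.le_sup (f := Finset.card) hRb
    simp only [rank]
    omega

end Restriction

/-! ### From geometric realizations to cones. -/

section Realization

variable {E : Type*} [AddCommGroup E] [Module ℝ E]

/-- The homogenized position map: a weight function is sent to the weighted sum of the positions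
together with the total weight. -/
def posMap (p : V → E) : (V →₀ ℝ) →ₗ[ℝ] E × ℝ :=
  Finsupp.linearCombination ℝ fun v => (p v, (1 : ℝ))

lemma posMap_apply (p : V → E) {y : V →₀ ℝ} {F : Finset V} (h : y.support ⊆ F) :
    posMap p y = (∑ v ∈ F, y v • p v, ∑ v ∈ F, y v) := by
  rw [posMap, Finsupp.linearCombination_apply, Finsupp.sum_of_support_subset y h _ (by simp)]
  ext <;> simp [Prod.fst_sum, Prod.snd_sum]

lemma mem_convexHull_image_iff (p : V → E) (F : Finset V) (x : E) :
    x ∈ convexHull ℝ (p '' (F : Set V)) ↔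
      ∃ y : V →₀ ℝ, 0 ≤ y ∧ y.support ⊆ F ∧ posMap p y = (x, 1) := by
  constructor
  · have hconv : Convex ℝ {x : E | ∃ y : V →₀ ℝ, 0 ≤ y ∧ y.support ⊆ F ∧
        posMap p y = (x, 1)} := by
      rintro x₁ ⟨y₁, h₁, hs₁, he₁⟩ x₂ ⟨y₂, h₂, hs₂, he₂⟩ a b ha hb hab
      refine ⟨a • y₁ + b • y₂, add_nonneg (smul_nonneg ha h₁) (smul_nonneg hb h₂),
        support_add_smul_subset (Finsupp.support_smul.trans hs₁) hs₂ b, ?_⟩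
      simp [he₁, he₂, hab]
    refine fun hx => convexHull_min ?_ hconv hx
    rintro _ ⟨v, hv, rfl⟩
    exact ⟨Finsupp.single v 1, Finsupp.single_nonneg.2 zero_le_one,
      Finsupp.support_single_subset.trans (by simpa using hv), by simp [posMap]⟩
  · rintro ⟨y, hy, hs, he⟩
    rw [posMap_apply p hs, Prod.mk.injEq] at he
    rw [← he.1]
    exact (convex_convexHull ℝ _).sum_mem (fun v _ => hy v) he.2 fun v hv =>
      subset_convexHull ℝ _ ⟨v, hv, rfl⟩

lemma eq_zero_of_mass_eq_zero (p : V → E) {y : V →₀ ℝ} (hy : 0 ≤ y) (h : (posMap p y).2 = 0) :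
    y = 0 := by
  rw [posMap_apply p subset_rfl] at h
  ext v
  by_cases hv : v ∈ y.support
  · exact (Finset.sum_eq_zero_iff_of_nonneg fun v _ => hy v).1 h v hv
  · simpa using hv

lemma mass_nonneg (p : V → E) {y : V →₀ ℝ} (hy : 0 ≤ y) : 0 ≤ (posMap p y).2 := by
  rw [posMap_apply p subset_rfl]
  exact Finset.sum_nonneg fun v _ => hy v

/-- The normalization of a nonzero weight function is a point of the simplex of its support. -/
lemma inv_mass_smul_mem_convexHull (p : V → E) {y : V →₀ ℝ} (hy : 0 ≤ y)
    (h : (posMap p y).2 ≠ 0) :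
    (posMap p y).2⁻¹ • (posMap p y).1 ∈ convexHull ℝ (p '' (y.support : Set V)) := by
  rw [mem_convexHull_image_iff]
  refine ⟨(posMap p y).2⁻¹ • y, smul_nonneg (inv_nonneg.2 (mass_nonneg p hy)) hy,
    Finsupp.support_smul, ?_⟩
  rw [map_smul]
  ext <;> simp [h]

variable {Δ : FinComplex V} {K : Geometry.SimplicialComplex ℝ E} {p : V → E}

lemma IsRealization.injOn_face (h : Δ.IsRealization K p) {F : Finset V} (hF : F ∈ Δ.faces) :
    Set.InjOn p (F : Set V) :=
  h.1.mono fun _ hv => Δ.down_closed _ _ hF (Finset.singleton_subset_iff.2 hv)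

lemma IsRealization.image_mem (h : Δ.IsRealization K p) {F : Finset V} (hF : F ∈ Δ.faces)
    (hne : F.Nonempty) : F.image p ∈ K.faces := by
  rw [h.2]
  exact ⟨F, hF, hne, by simp⟩

lemma IsRealization.exists_face (h : Δ.IsRealization K p) {F : Finset V} (hF : F ∈ Δ.faces)
    (hne : F.Nonempty) : ∃ s ∈ K.faces, (s : Set E) = p '' (F : Set V) :=
  ⟨_, h.image_mem hF hne, Finset.coe_image⟩

/-- Affine independence of the points `p v` is linear independence of the vectors `(p v, 1)`. -/
lemma IsRealization.eq_zero (h : Δ.IsRealization K p) {F : Finset V} (hF : F ∈ Δ.faces)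
    {d : V →₀ ℝ} (hd : d.support ⊆ F) (h0 : posMap p d = 0) : d = 0 := by
  rcases F.eq_empty_or_nonempty with rfl | hne
  · simpa using hd
  have hind := K.indep (h.image_mem hF hne)
  let e : F ↪ (F.image p : Finset E) :=
    ⟨fun v => ⟨p v, Finset.mem_image_of_mem p v.2⟩, fun a b hab =>
      Subtype.ext (h.injOn_face hF a.2 b.2 (congrArg Subtype.val hab))⟩
  have hind' := hind.comp_embedding e
  rw [posMap_apply p hd, Prod.mk_eq_zero] at h0
  have key := hind'.eq_zero_of_sum_eq_zero (s := Finset.univ) (w := fun v : F => d v)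
    (by rw [← h0.2]; exact Finset.sum_coe_sort F fun v => d v)
    (by rw [← h0.1]; exact Finset.sum_coe_sort F fun v => d v • p v)
  ext v
  by_cases hv : v ∈ F
  · exact key ⟨v, hv⟩ (Finset.mem_univ _)
  · simpa using fun h => hv (hd h)

/-- Barycentric coordinates with respect to a geometric simplicial complex are unique. -/
lemma IsRealization.injOn_posMap (h : Δ.IsRealization K p) : Set.InjOn (posMap p) Δ.cone := by
  intro y hy z hz hyz
  by_cases h0 : (posMap p y).2 = 0
  · rw [eq_zero_of_mass_eq_zero p hy.1 h0, eq_zero_of_mass_eq_zero p hz.1 (hyz ▸ h0)]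
  have hyx := inv_mass_smul_mem_convexHull p hy.1 h0
  have hzx := inv_mass_smul_mem_convexHull p hz.1 (hyz ▸ h0)
  rw [← hyz] at hzx
  have ne : ∀ {u : V →₀ ℝ}, (posMap p u).2 ≠ 0 → u.support.Nonempty := by
    intro u hu
    rw [Finsupp.support_nonempty_iff]
    rintro rfl
    simp at hu
  -- Both simplices contain the normalized point, so it is a convex combination `u` of their common
  -- vertices; uniqueness within each face then makes `y` and `z` the same multiple of `u`.
  have hmem := K.inter_subset_convexHull (h.image_mem hy.2 (ne h0))
    (h.image_mem hz.2 (ne (hyz ▸ h0)))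
    (a := (posMap p y).2⁻¹ • (posMap p y).1) (by simpa using ⟨hyx, hzx⟩)
  have himg : (((y.support.image p : Finset E) : Set E) ∩ ((z.support.image p : Finset E) : Set E))
      ⊆ p '' ((y.support ∩ z.support : Finset V) : Set V) := by
    rintro _ ⟨hx1, hx2⟩
    simp only [Finset.coe_image, Set.mem_image, Finset.mem_coe] at hx1 hx2
    obtain ⟨v, hv, rfl⟩ := hx1
    obtain ⟨v', hv', he⟩ := hx2
    have : v' = v := h.1 (Δ.down_closed _ _ hz.2 (Finset.singleton_subset_iff.2 hv'))
      (Δ.down_closed _ _ hy.2 (Finset.singleton_subset_iff.2 hv)) he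
    subst this
    exact ⟨v', by simpa using Finset.mem_inter.2 ⟨hv, hv'⟩, rfl⟩
  obtain ⟨u, -, hus, hue⟩ := (mem_convexHull_image_iff p _ _).1 (convexHull_mono himg hmem)
  have hu : posMap p ((posMap p y).2 • u) = posMap p y := by
    rw [map_smul, hue]
    ext <;> simp [h0]
  have aux : ∀ {x : V →₀ ℝ}, x ∈ Δ.cone → u.support ⊆ x.support → posMap p x = posMap p y →
      x = (posMap p y).2 • u := by
    intro x hx hux hxy
    rw [← sub_eq_zero]
    exact h.eq_zero hx.2 (Finsupp.support_sub.trans (Finset.union_subset subset_rfl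
      (Finsupp.support_smul.trans hux))) (by rw [map_sub, hxy, hu, sub_self])
  rw [aux hy (hus.trans Finset.inter_subset_left) rfl,
    aux hz (hus.trans Finset.inter_subset_right) hyz.symm]

lemma IsRealization.mem_space_iff (h : Δ.IsRealization K p) (x : E) :
    x ∈ K.space ↔ ∃ y ∈ Δ.cone, posMap p y = (x, 1) := by
  rw [Geometry.SimplicialComplex.mem_space_iff]
  constructor
  · rintro ⟨s, hs, hx⟩
    rw [h.2] at hs
    obtain ⟨F, hF, -, hsF⟩ := hs
    rw [hsF, mem_convexHull_image_iff] at hx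
    obtain ⟨y, hy, hyF, hyx⟩ := hx
    exact ⟨y, mem_cone hy hF hyF, hyx⟩
  · rintro ⟨y, hy, hyx⟩
    have hne : y.support.Nonempty := by
      rw [Finsupp.support_nonempty_iff]
      rintro rfl
      simp [Prod.ext_iff] at hyx
    refine ⟨y.support.image p, h.image_mem hy.2 hne, ?_⟩
    rw [Finset.coe_image, mem_convexHull_image_iff]
    exact ⟨y, hy.1, subset_rfl, hyx⟩

end Realization

/-- A triangulation induces a linear map that identifies the cones over the two complexes. -/
lemma Triangulation.exists_bijOn_cone (T : Triangulation Δ' Δ) :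
    ∃ L : (W →₀ ℝ) →ₗ[ℝ] (V →₀ ℝ), Set.BijOn L Δ'.cone Δ.cone ∧
      ∀ F ∈ Δ.faces, ∀ G, G ∈ (T.restrict F).faces ↔ G ∈ Δ'.faces ∧ carrier L G ⊆ F := by
  have hK := T.realizes
  have hK' := T.realizes'
  have hspace : ∀ x, x ∈ T.K'.space ↔ x ∈ T.K.space := fun x => by rw [T.subdivides.1]
  -- Barycentric coordinates in `K` of each vertex of `Δ'`; the value at other elements of `W` is
  -- irrelevant.
  have hvert : ∀ w, ∃ y : V →₀ ℝ, {w} ∈ Δ'.faces →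
      y ∈ Δ.cone ∧ posMap T.pos y = (T.pos' w, 1) := by
    intro w
    by_cases hw : {w} ∈ Δ'.faces
    · have h1 : T.pos' w ∈ T.K'.space := (hK'.mem_space_iff _).2
        ⟨Finsupp.single w 1, mem_cone (Finsupp.single_nonneg.2 zero_le_one) hw
          Finsupp.support_single_subset, by simp [posMap]⟩
      obtain ⟨y, hy, hyw⟩ := (hK.mem_space_iff _).1 ((hspace _).1 h1)
      exact ⟨y, fun _ => ⟨hy, hyw⟩⟩
    · exact ⟨0, fun h => absurd h hw⟩
  choose c hc using hvert
  have vmem : ∀ {G w}, G ∈ Δ'.faces → w ∈ G → {w} ∈ Δ'.faces := fun hG hw =>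
    Δ'.down_closed _ _ hG (Finset.singleton_subset_iff.2 hw)
  set L := Finsupp.linearCombination ℝ c with hLdef
  have hLapply : ∀ {a : W →₀ ℝ} {G : Finset W}, a.support ⊆ G → L a = ∑ w ∈ G, a w • c w := by
    intro a G h
    rw [hLdef, Finsupp.linearCombination_apply, Finsupp.sum_of_support_subset a h _ (by simp)]
  have hpos : ∀ a ∈ Δ'.cone, posMap T.pos (L a) = posMap T.pos' a := by
    intro a ha
    rw [hLapply subset_rfl, map_sum, posMap, posMap, Finsupp.linearCombination_apply, Finsupp.sum,
      ← posMap]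
    refine Finset.sum_congr rfl fun w hw => ?_
    rw [map_smul, (hc w (vmem ha.2 hw)).2]
  have hsub : ∀ F ∈ Δ.faces, ∀ G ∈ Δ'.faces,
      convexHull ℝ (T.pos' '' (G : Set W)) ⊆ convexHull ℝ (T.pos '' (F : Set V)) ↔
        ∀ w ∈ G, (c w).support ⊆ F := by
    intro F hF G hG
    constructor
    · intro h w hw
      obtain ⟨y, hy, hyF, hyw⟩ := (mem_convexHull_image_iff _ _ _).1
        (h (subset_convexHull ℝ _ ⟨w, hw, rfl⟩))
      obtain ⟨h1, h2⟩ := hc w (vmem hG hw)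
      rwa [← hK.injOn_posMap (mem_cone hy hF hyF) h1 (hyw.trans h2.symm)]
    · intro h
      refine convexHull_min ?_ (convex_convexHull ℝ _)
      rintro _ ⟨w, hw, rfl⟩
      obtain ⟨h1, h2⟩ := hc w (vmem hG hw)
      exact (mem_convexHull_image_iff _ _ _).2 ⟨c w, h1.1, h w hw, h2⟩
  have hsupp : ∀ {a : W →₀ ℝ} {G : Finset W} {F : Finset V}, a.support ⊆ G →
      (∀ w ∈ G, (c w).support ⊆ F) → (L a).support ⊆ F := by
    intro a G F ha h
    rw [hLapply ha]
    refine Finsupp.support_finsetSum.trans (Finset.biUnion_subset.2 fun w hw => ?_)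
    exact Finsupp.support_smul.trans (h w hw)
  have hmaps : Set.MapsTo L Δ'.cone Δ.cone := by
    intro a ha
    -- The apex of the cone corresponds to the empty face, which only `T.empty_mem_iff` controls.
    rcases a.support.eq_empty_or_nonempty with h0 | hne
    · have h1 := ha.2
      rw [h0] at h1
      rw [Finsupp.support_eq_empty.1 h0, map_zero]
      exact mem_cone le_rfl (T.empty_mem_iff.1 h1) (by simp)
    · obtain ⟨s, hs, hsa⟩ := hK'.exists_face ha.2 hne
      obtain ⟨t, ht, hat⟩ := T.subdivides.2 s hs
      rw [hK.2] at ht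
      obtain ⟨F, hF, -, htF⟩ := ht
      rw [hsa, htF, hsub F hF _ ha.2] at hat
      refine mem_cone ?_ hF (hsupp subset_rfl hat)
      rw [hLapply subset_rfl]
      exact Finset.sum_nonneg fun w hw => smul_nonneg (ha.1 w) (hc w (vmem ha.2 hw)).1.1
  have hbij : Set.BijOn L Δ'.cone Δ.cone := by
    refine ⟨hmaps, fun a ha b hb hab => ?_, fun y hy => ?_⟩
    · exact hK'.injOn_posMap ha hb (by rw [← hpos a ha, ← hpos b hb, hab])
    · by_cases h0 : (posMap T.pos y).2 = 0
      · have hy0 := eq_zero_of_mass_eq_zero _ hy.1 h0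
        have h1 := hy.2
        rw [hy0, Finsupp.support_zero] at h1
        exact ⟨0, mem_cone le_rfl (T.empty_mem_iff.2 h1) (by simp), by simp [hy0]⟩
      · have hn := mass_nonneg T.pos hy.1
        have h1 : (posMap T.pos y).2⁻¹ • (posMap T.pos y).1 ∈ T.K.space :=
          (hK.mem_space_iff _).2 ⟨(posMap T.pos y).2⁻¹ • y,
            mem_cone (smul_nonneg (inv_nonneg.2 hn) hy.1) hy.2 Finsupp.support_smul, by
              rw [map_smul]; ext <;> simp [h0]⟩
        obtain ⟨a, ha, hae⟩ := (hK'.mem_space_iff _).1 ((hspace _).2 h1)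
        have ha' : (posMap T.pos y).2 • a ∈ Δ'.cone :=
          mem_cone (smul_nonneg hn ha.1) ha.2 Finsupp.support_smul
        refine ⟨(posMap T.pos y).2 • a, ha', hK.injOn_posMap (hmaps ha') hy ?_⟩
        rw [hpos _ ha', map_smul, hae]
        ext <;> simp [h0]
  refine ⟨L, hbij, fun F hF G => ?_⟩
  simp only [restrict, Finset.mem_filter]
  refine and_congr_right fun hG => ?_
  rw [hsub F hF G hG]
  refine ⟨fun h => hsupp (support_ones G).subset h, fun h w hw => ?_⟩
  have h1 := support_map_subset_carrier hbij hG (a := Finsupp.single w 1)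
    (Finsupp.support_single_subset.trans (Finset.singleton_subset_iff.2 hw))
  rw [hLdef, Finsupp.linearCombination_single, one_smul] at h1
  exact h1.trans h

/-! ### Chains of faces and the h-polynomial of subdivided links. -/

lemma hPoly_eq_sum (Δ : FinComplex V) :
    Δ.hPoly = ∑ G ∈ Δ.faces, X ^ G.card * (1 - X) ^ (Δ.rank - G.card) := by
  have hmaps : ∀ G ∈ Δ.faces, G.card ∈ Finset.range (Δ.rank + 1) := fun G hG =>
    Finset.mem_range.2 (Nat.lt_succ_of_le (Finset.le_sup (f := Finset.card) hG))
  rw [hPoly, ← Finset.sum_fiberwise_of_maps_to hmaps]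
  refine Finset.sum_congr rfl fun i _ => ?_
  rw [Finset.sum_congr rfl (g := fun _ => (X ^ i * (1 - X) ^ (Δ.rank - i) : ℝ[X]))
    fun G hG => by rw [(Finset.mem_filter.1 hG).2]]
  rw [Finset.sum_const, numFaces, nsmul_eq_mul, mul_assoc]
  simp

lemma card_le_rank {Δ : FinComplex V} {F : Finset V} (hF : F ∈ Δ.faces) : F.card ≤ Δ.rank :=
  Finset.le_sup (f := Finset.card) hF

/-- The chains of faces that properly contain `E`. -/
def chainsAbove (Δ : FinComplex V) (E : Finset V) : Finset (Finset (Finset V)) :=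
  (Δ.faces.filter fun F => E ⊂ F).powerset.filter
    fun c => IsChain (fun F G : Finset V => F ⊆ G) (c : Set (Finset V))

lemma mem_chainsAbove {Δ : FinComplex V} {E : Finset V} {c : Finset (Finset V)} :
    c ∈ Δ.chainsAbove E ↔ (∀ F ∈ c, F ∈ Δ.faces ∧ E ⊂ F) ∧
      IsChain (fun F G : Finset V => F ⊆ G) (c : Set (Finset V)) := by
  simp [chainsAbove, Finset.subset_iff]

/-- Cardinality is injective on a chain, with values above `E.card` and at most the rank. This keeps
the truncated subtractions in later exponents honest. -/
lemma card_chain_le {Δ : FinComplex V} {E : Finset V} {c : Finset (Finset V)}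
    (hc : c ∈ Δ.chainsAbove E) : c.card ≤ Δ.rank - E.card := by
  rw [mem_chainsAbove] at hc
  have hinj : Set.InjOn Finset.card (c : Set (Finset V)) := by
    intro F hF G hG hFG
    rcases hc.2.total hF hG with h | h
    · exact Finset.eq_of_subset_of_card_le h hFG.ge
    · exact (Finset.eq_of_subset_of_card_le h hFG.le).symm
  rw [← Nat.card_Ioc]
  refine Finset.card_le_card_of_injOn Finset.card (fun F hF => ?_) hinj
  obtain ⟨h1, h2⟩ := hc.1 F hF
  simpa using ⟨Finset.card_lt_card h2, card_le_rank h1⟩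

lemma mem_faces_sd {Δ : FinComplex V} {c : Finset (Finset V)} :
    c ∈ Δ.sd.faces ↔ (∀ F ∈ c, F ≠ ∅ ∧ F ∈ Δ.faces) ∧
      IsChain (fun F G : Finset V => F ⊆ G) (c : Set (Finset V)) := by
  simp [sd, Finset.subset_iff]

lemma exists_full_flag (F : Finset V) : ∃ c : Finset (Finset V), c.card = F.card ∧
    (∀ G ∈ c, G ≠ ∅ ∧ G ⊆ F) ∧
      IsChain (fun F G : Finset V => F ⊆ G) (c : Set (Finset V)) := by
  induction F using Finset.induction_on with
  | empty => exact ⟨∅, by simp⟩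
  | insert a s ha ih =>
    obtain ⟨c, hc, hcs, hch⟩ := ih
    refine ⟨insert (insert a s) c, ?_, ?_, ?_⟩
    · rw [Finset.card_insert_of_notMem, Finset.card_insert_of_notMem ha, hc]
      exact fun h => ha ((hcs _ h).2 (Finset.mem_insert_self a s))
    · intro G hG
      rcases Finset.mem_insert.1 hG with rfl | hG
      · exact ⟨Finset.insert_ne_empty a s, subset_rfl⟩
      · exact ⟨(hcs G hG).1, (hcs G hG).2.trans (Finset.subset_insert a s)⟩
    · rw [Finset.coe_insert]
      exact hch.insert fun G hG _ => Or.inr ((hcs G hG).2.trans (Finset.subset_insert a s))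

lemma rank_sd (Δ : FinComplex V) : Δ.sd.rank = Δ.rank := by
  apply le_antisymm
  · refine Finset.sup_le fun c hc => ?_
    rw [mem_faces_sd] at hc
    have : c ∈ Δ.chainsAbove ∅ := mem_chainsAbove.2
      ⟨fun F hF => ⟨(hc.1 F hF).2, Finset.empty_ssubset.2
        (Finset.nonempty_iff_ne_empty.2 (hc.1 F hF).1)⟩, hc.2⟩
    simpa using card_chain_le this
  · refine Finset.sup_le fun F hF => ?_
    obtain ⟨c, hc, hcF, hch⟩ := exists_full_flag F
    rw [← hc]
    exact card_le_rank (mem_faces_sd.2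
      ⟨fun G hG => ⟨(hcF G hG).1, Δ.down_closed _ _ hF (hcF G hG).2⟩, hch⟩)

lemma mem_faces_link {Δ : FinComplex V} {E G : Finset V} :
    G ∈ (Δ.link E).faces ↔ ∃ F ∈ Δ.faces, E ⊆ F ∧ F \ E = G := by
  simp [link, and_assoc]

/-- This is where purity enters: every `E` lies in a facet of full rank. -/
lemma rank_link {Δ : FinComplex V} (hΔ : Δ.IsPure) {E : Finset V} (hE : E ∈ Δ.faces) :
    (Δ.link E).rank = Δ.rank - E.card := by
  apply le_antisymm
  · refine Finset.sup_le fun G hG => ?_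
    obtain ⟨F, hF, hEF, rfl⟩ := mem_faces_link.1 hG
    rw [Finset.card_sdiff_of_subset hEF]
    exact Nat.sub_le_sub_right (card_le_rank hF) _
  · obtain ⟨T, hT, hET⟩ := exists_facet_superset Δ hE
    have hr : Δ.rank ≤ T.card := Finset.sup_le fun F hF => by
      obtain ⟨S, hS, hFS⟩ := exists_facet_superset Δ hF
      exact (Finset.card_le_card hFS).trans (hΔ S hS T hT).le
    calc Δ.rank - E.card ≤ T.card - E.card := Nat.sub_le_sub_right hr _
      _ = (T \ E).card := (Finset.card_sdiff_of_subset hET).symm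
      _ ≤ _ := card_le_rank (mem_faces_link.2 ⟨T, (mem_facets.1 hT).1, hET, rfl⟩)

/-- Adjoining `E` to each member turns chains in the link into chains in `Δ` above `E`, so different
links can be compared inside `Δ`. -/
lemma hPoly_sd_link {Δ : FinComplex V} (hΔ : Δ.IsPure) {E : Finset V} (hE : E ∈ Δ.faces) :
    (Δ.link E).sd.hPoly =
      ∑ c ∈ Δ.chainsAbove E, X ^ c.card * (1 - X) ^ (Δ.rank - E.card - c.card) := by
  rw [hPoly_eq_sum, rank_sd, rank_link hΔ hE]
  have hdisj : ∀ c ∈ (Δ.link E).sd.faces, ∀ G ∈ c, (G ∪ E) \ E = G ∧ G ∪ E ∈ Δ.faces ∧ G ≠ ∅ := by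
    intro c hc G hG
    obtain ⟨hne, hmem⟩ := (mem_faces_sd.1 hc).1 G hG
    obtain ⟨F, hF, hEF, rfl⟩ := mem_faces_link.1 hmem
    rw [Finset.sdiff_union_of_subset hEF]
    exact ⟨rfl, hF, hne⟩
  have himage : ∀ c ∈ (Δ.link E).sd.faces, (c.image (· ∪ E)).image (· \ E) = c := by
    intro c hc
    rw [Finset.image_image]
    conv_rhs => rw [← Finset.image_id (s := c)]
    exact Finset.image_congr fun G hG => (hdisj c hc G hG).1
  refine Finset.sum_nbij' (fun c => c.image (· ∪ E)) (fun d => d.image (· \ E)) ?_ ?_ himage ?_ ?_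
  · intro c hc
    rw [mem_chainsAbove]
    constructor
    · intro F hF
      obtain ⟨G, hG, rfl⟩ := Finset.mem_image.1 hF
      obtain ⟨h1, h2, h3⟩ := hdisj c hc G hG
      refine ⟨h2, Finset.subset_union_right.ssubset_of_ne fun h => h3 ?_⟩
      rw [← h1, ← h, Finset.sdiff_self]
    · rw [Finset.coe_image]
      exact (mem_faces_sd.1 hc).2.image_of_map_rel _ _ _ fun F G h =>
        Finset.union_subset_union_left h
  · intro d hd
    obtain ⟨h1, h2⟩ := mem_chainsAbove.1 hd
    rw [mem_faces_sd]
    constructor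
    · intro G hG
      obtain ⟨F, hF, rfl⟩ := Finset.mem_image.1 hG
      obtain ⟨h3, h4⟩ := h1 F hF
      exact ⟨fun h => h4.2 (Finset.sdiff_eq_empty_iff_subset.1 h),
        mem_faces_link.2 ⟨F, h3, h4.1, rfl⟩⟩
    · rw [Finset.coe_image]
      exact h2.image_of_map_rel _ _ _ fun F G h => Finset.sdiff_subset_sdiff h subset_rfl
  · intro d hd
    rw [Finset.image_image]
    conv_rhs => rw [← Finset.image_id (s := d)]
    exact Finset.image_congr fun G hG =>
      Finset.sdiff_union_of_subset ((mem_chainsAbove.1 hd).1 G hG).2.1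
  · intro c hc
    have : (c.image (· ∪ E)).card = c.card := by
      refine le_antisymm Finset.card_image_le ?_
      conv_lhs => rw [← himage c hc]
      exact Finset.card_image_le
    simp only [this]

/-- A sum over chains, split according to the least element of the chain. -/
lemma sum_chainsAbove {M : Type*} [AddCommMonoid M] (Δ : FinComplex V) (E : Finset V)
    (f : Finset (Finset V) → M) :
    ∑ c ∈ Δ.chainsAbove E, f c =
      f ∅ + ∑ F ∈ Δ.faces.filter (fun F => E ⊂ F), ∑ c ∈ Δ.chainsAbove F, f (insert F c) := by
  have h0 : ∅ ∈ Δ.chainsAbove E := mem_chainsAbove.2 (by simp)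
  rw [← Finset.add_sum_erase _ _ h0, Finset.sum_sigma']
  congr 1
  symm
  refine Finset.sum_bij (fun p _ => insert p.1 p.2) ?_ ?_ ?_ fun _ _ => rfl
  · rintro ⟨F, c⟩ h
    simp only [Finset.mem_sigma, Finset.mem_filter, mem_chainsAbove] at h
    obtain ⟨⟨hF, hEF⟩, hc, hch⟩ := h
    rw [Finset.mem_erase, mem_chainsAbove]
    refine ⟨Finset.insert_ne_empty F c, ?_, ?_⟩
    · intro G hG
      rcases Finset.mem_insert.1 hG with rfl | hG
      · exact ⟨hF, hEF⟩
      · exact ⟨(hc G hG).1, hEF.trans (hc G hG).2⟩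
    · rw [Finset.coe_insert]
      exact hch.insert fun G hG _ => Or.inl (hc G hG).2.1
  · rintro ⟨F, c⟩ h ⟨F', c'⟩ h' heq
    simp only [Finset.mem_sigma, mem_chainsAbove] at h h' heq
    have hFc : F ∉ c := fun hF => (h.2.1 F hF).2.ne rfl
    have hFc' : F' ∉ c' := fun hF => (h'.2.1 F' hF).2.ne rfl
    obtain rfl : F = F' := by
      by_contra hne
      have h1 : F ∈ c' := Finset.mem_of_mem_insert_of_ne (heq ▸ Finset.mem_insert_self F c) hne
      have h2 : F' ∈ c :=
        Finset.mem_of_mem_insert_of_ne (heq ▸ Finset.mem_insert_self F' c') (Ne.symm hne)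
      exact hne ((h.2.1 F' h2).2.1.antisymm (h'.2.1 F h1).2.1)
    rw [← Finset.erase_insert hFc, heq, Finset.erase_insert hFc']
  · intro d hd
    rw [Finset.mem_erase, mem_chainsAbove] at hd
    obtain ⟨hne, hd, hch⟩ := hd
    -- In a chain a minimal element is the least one.
    obtain ⟨F, hF⟩ := Finset.exists_minimal (Finset.nonempty_iff_ne_empty.2 hne)
    refine ⟨⟨F, d.erase F⟩, ?_, Finset.insert_erase hF.1⟩
    simp only [Finset.mem_sigma, Finset.mem_filter, mem_chainsAbove]
    refine ⟨hd F hF.1, fun G hG => ?_, hch.mono (by simp)⟩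
    rw [Finset.mem_erase] at hG
    refine ⟨(hd G hG.2).1, LE.le.ssubset_of_ne ?_ hG.1.symm⟩
    rcases hch.total hF.1 hG.2 with h | h
    · exact h
    · exact hF.2 hG.2 h

/-- The empty chain gives the first term. In any other chain the least element `F` contributes the
factor `X`, and the rest is a chain above `F`. -/
lemma hPoly_sd_link_recursion {Δ : FinComplex V} (hΔ : Δ.IsPure) {E : Finset V}
    (hE : E ∈ Δ.faces) :
    (Δ.link E).sd.hPoly = (1 - X) ^ (Δ.rank - E.card) +
      X * ∑ F ∈ Δ.faces.filter (fun F => E ⊂ F),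
        (1 - X) ^ (F.card - 1 - E.card) * (Δ.link F).sd.hPoly := by
  rw [hPoly_sd_link hΔ hE, sum_chainsAbove, Finset.card_empty, pow_zero, one_mul, Nat.sub_zero,
    Finset.mul_sum]
  congr 1
  refine Finset.sum_congr rfl fun F hF => ?_
  rw [Finset.mem_filter] at hF
  rw [hPoly_sd_link hΔ hF.1, Finset.mul_sum, Finset.mul_sum]
  refine Finset.sum_congr rfl fun c hc => ?_
  have hFc : F ∉ c := fun h => ((mem_chainsAbove.1 hc).1 F h).2.ne rfl
  have h1 := card_chain_le hc
  have h2 := card_le_rank hF.1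
  have h3 := Finset.card_lt_card hF.2
  rw [Finset.card_insert_of_notMem hFc,
    show Δ.rank - E.card - (c.card + 1) = (F.card - 1 - E.card) + (Δ.rank - F.card - c.card) by
      omega, pow_add, pow_succ]
  ring

/-! ### Sorting by carrier, theta polynomials and the final summation. -/

section Carrier

/-- The contribution to the `h`-polynomial of the faces of `Δ'` in the interior of the face `F`. -/
def interiorPoly (Δ' : FinComplex W) (L : (W →₀ ℝ) →ₗ[ℝ] (V →₀ ℝ)) (F : Finset V) : ℝ[X] :=
  ∑ s ∈ Δ'.faces.filter (fun s => carrier L s = F), X ^ s.card * (1 - X) ^ (F.card - s.card)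

/-- A sum over the faces with carrier in a given family, split according to the carrier. -/
lemma sum_eq_sum_interiorPoly (hL : Set.BijOn L Δ'.cone Δ.cone) {S : Finset (Finset W)}
    {A : Finset (Finset V)} (hS : ∀ s, s ∈ S ↔ s ∈ Δ'.faces ∧ carrier L s ∈ A) {m : ℕ}
    (hm : ∀ F ∈ A, F.card ≤ m) :
    ∑ s ∈ S, X ^ s.card * (1 - X) ^ (m - s.card) =
      ∑ F ∈ A, (1 - X) ^ (m - F.card) * interiorPoly Δ' L F := by
  rw [← Finset.sum_fiberwise_of_maps_to fun s hs => ((hS s).1 hs).2]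
  refine Finset.sum_congr rfl fun F hF => ?_
  rw [interiorPoly, Finset.mul_sum]
  have hfil : S.filter (fun s => carrier L s = F) =
      Δ'.faces.filter (fun s => carrier L s = F) := by
    ext s
    simp only [Finset.mem_filter, hS]
    constructor
    · exact fun h => ⟨h.1.1, h.2⟩
    · exact fun h => ⟨⟨h.1, h.2 ▸ hF⟩, h.2⟩
  rw [hfil]
  refine Finset.sum_congr rfl fun s hs => ?_
  rw [Finset.mem_filter] at hs
  have h1 := card_le_of_carrier_subset hL hs.1 hs.2.subset
  have h2 := hm F hF
  rw [show m - s.card = (m - F.card) + (F.card - s.card) by omega, pow_add]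
  ring

/-- The boundary has rank one less, so each proper subface `E` contributes (1-x)^(k+1) - (1-x)^k =
-x(1-x)^k with k = |F|-1-|E|. -/
lemma theta_eq (hL : Set.BijOn L Δ'.cone Δ.cone) {F : Finset V} (hF : F ∈ Δ.faces)
    {Γ : FinComplex W} (hΓ : ∀ s, s ∈ Γ.faces ↔ s ∈ Δ'.faces ∧ carrier L s ⊆ F) :
    Γ.theta = interiorPoly Δ' L F - X * ∑ E ∈ Δ.faces.filter (fun E => E ⊂ F),
      (1 - X) ^ (F.card - 1 - E.card) * interiorPoly Δ' L E := by
  have hfaces : ∑ s ∈ Γ.faces, X ^ s.card * (1 - X) ^ (F.card - s.card) =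
      ∑ E ∈ insert F (Δ.faces.filter (fun E => E ⊂ F)),
        (1 - X) ^ (F.card - E.card) * interiorPoly Δ' L E := by
    refine sum_eq_sum_interiorPoly hL (fun s => ?_) fun E hE => ?_
    · rw [hΓ]
      refine and_congr_right fun hs => ?_
      rw [Finset.mem_insert, Finset.mem_filter, subset_iff_ssubset_or_eq, or_comm]
      simp [carrier_mem hL hs]
    · rw [Finset.mem_insert, Finset.mem_filter] at hE
      rcases hE with rfl | hE
      · exact le_rfl
      · exact Finset.card_le_card hE.2.1
  have hbd : Γ.boundary.hPoly = ∑ E ∈ Δ.faces.filter (fun E => E ⊂ F),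
      (1 - X) ^ (F.card - 1 - E.card) * interiorPoly Δ' L E := by
    have hmem : ∀ s, s ∈ Γ.boundary.faces ↔
        s ∈ Δ'.faces ∧ carrier L s ∈ Δ.faces.filter (fun E => E ⊂ F) := by
      intro s
      rw [mem_faces_boundary hL hF hΓ, hΓ, and_assoc, ← Finset.ssubset_iff_subset_ne,
        Finset.mem_filter]
      exact and_congr_right fun hs => by simp [carrier_mem hL hs]
    rw [hPoly_eq_sum]
    -- The boundary over the empty face is void and contributes 0.
    rcases F.eq_empty_or_nonempty with rfl | hne
    · have h0 : Γ.boundary.faces = ∅ := by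
        ext s
        simp [hmem]
      simp [h0]
    · rw [rank_boundary hL hF hΓ hne]
      refine sum_eq_sum_interiorPoly hL hmem fun E hE => ?_
      have := Finset.card_lt_card (Finset.mem_filter.1 hE).2
      omega
  rw [theta, hPoly_eq_sum Γ, rank_restriction hL hF hΓ, hfaces, hbd,
    Finset.sum_insert (by simp), Nat.sub_self, pow_zero, one_mul, add_sub_assoc,
    ← Finset.sum_sub_distrib, Finset.mul_sum, sub_eq_add_neg (interiorPoly Δ' L F),
    ← Finset.sum_neg_distrib]
  congr 1
  refine Finset.sum_congr rfl fun E hE => ?_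
  have := Finset.card_lt_card (Finset.mem_filter.1 hE).2
  rw [show F.card - E.card = (F.card - 1 - E.card) + 1 by omega, pow_succ]
  ring

lemma rank_eq_of_bijOn (hL : Set.BijOn L Δ'.cone Δ.cone) : Δ'.rank = Δ.rank := by
  apply le_antisymm
  · exact Finset.sup_le fun s hs =>
      (card_le_of_carrier_subset hL hs subset_rfl).trans (card_le_rank (carrier_mem hL hs))
  · refine Finset.sup_le fun F hF => ?_
    rw [← rank_restriction hL hF fun _ => mem_faces_carrierRestrict hL]
    exact Finset.sup_mono (Finset.filter_subset _ _)

/-- The theta polynomial formula for a subdivision given by a map of cones. -/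
lemma hPoly_eq_sum_theta (hΔ : Δ.IsPure) (hL : Set.BijOn L Δ'.cone Δ.cone)
    (R : Finset V → FinComplex W)
    (hR : ∀ F ∈ Δ.faces, ∀ s, s ∈ (R F).faces ↔ s ∈ Δ'.faces ∧ carrier L s ⊆ F) :
    Δ'.hPoly = ∑ F ∈ Δ.faces, (R F).theta * (Δ.link F).sd.hPoly := by
  have hlhs : Δ'.hPoly =
      ∑ F ∈ Δ.faces, (1 - X) ^ (Δ.rank - F.card) * interiorPoly Δ' L F := by
    rw [hPoly_eq_sum, rank_eq_of_bijOn hL]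
    refine sum_eq_sum_interiorPoly hL (fun s => ?_) fun F hF => card_le_rank hF
    exact ⟨fun h => ⟨h, carrier_mem hL h⟩, fun h => h.1⟩
  have hswap : ∑ F ∈ Δ.faces, (∑ E ∈ Δ.faces.filter (fun E => E ⊂ F),
        (1 - X) ^ (F.card - 1 - E.card) * interiorPoly Δ' L E) * (Δ.link F).sd.hPoly =
      ∑ E ∈ Δ.faces, interiorPoly Δ' L E * ∑ F ∈ Δ.faces.filter (fun F => E ⊂ F),
        (1 - X) ^ (F.card - 1 - E.card) * (Δ.link F).sd.hPoly := by
    simp only [Finset.sum_mul, Finset.mul_sum, Finset.sum_filter]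
    rw [Finset.sum_comm]
    refine Finset.sum_congr rfl fun E _ => Finset.sum_congr rfl fun F _ => ?_
    split_ifs <;> ring
  have hrhs : ∑ F ∈ Δ.faces, (R F).theta * (Δ.link F).sd.hPoly =
      ∑ F ∈ Δ.faces, interiorPoly Δ' L F * (Δ.link F).sd.hPoly -
        X * ∑ F ∈ Δ.faces, (∑ E ∈ Δ.faces.filter (fun E => E ⊂ F),
          (1 - X) ^ (F.card - 1 - E.card) * interiorPoly Δ' L E) * (Δ.link F).sd.hPoly := by
    rw [Finset.mul_sum, ← Finset.sum_sub_distrib]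
    refine Finset.sum_congr rfl fun F hF => ?_
    rw [theta_eq hL hF (hR F hF)]
    ring
  rw [hlhs, hrhs, hswap, Finset.mul_sum, ← Finset.sum_sub_distrib]
  refine Finset.sum_congr rfl fun E hE => ?_
  -- By the recursion the coefficient of `interiorPoly Δ' L E` collapses to a power of `1 - X`.
  rw [hPoly_sd_link_recursion hΔ hE]
  ring

end Carrier

end

end FinComplex

theorem mainTheorem1 {V W : Type*} (Δ : FinComplex V) (hΔ : Δ.IsPure) (Δ' : FinComplex W)
    (T : FinComplex.Triangulation Δ' Δ) :
    Δ'.hPoly = ∑ F ∈ Δ.faces, (T.restrict F).theta * (Δ.link F).sd.hPoly := by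
  obtain ⟨L, hL, hR⟩ := T.exists_bijOn_cone
  exact FinComplex.hPoly_eq_sum_theta hΔ hL T.restrict hR
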